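/- Let $G=\langle X\mid R\rangle$ be a finite presentation, with $R$ a finite subset of the free group $F(X)$. Let $M(G)$ be its Miller machine, that is, the group generated by $X$, letters $\theta_\alpha$ ($\alpha\in X\sqcup R$) and a letter $q$, with defining relations $\theta_\alpha x=x\theta_\alpha$ ($x\in X$, $\alpha\in X\sqcup R$), $\theta_x x q=q x\theta_x$ ($x\in X$) and $\theta_r q=q r\theta_r$ ($r\in R$). Write $\|w\|$ for the length of the reduced form of a word $w$ in $F(X)$, and $|\gamma|$ for the word length of $\gamma\in M(G)$ with respect to these generators. For conjugate $x,y\in M(G)$ put $c(x,y)=\min\{|\gamma| : \gamma x\gamma^{-1}=y \text{ in } M(G)\}$, and for $n\ge 2$ let $$D_0(n)=\max\{c(q,qu) : u\in F(X),\ \|u\|\le n-2,\ q \text{ and } qu \text{ are conjugate in } M(G)\}.$$ For an expression $\prod_{j=1}^m w_jr_jw_j^{-1}$ with $w_j\in F(X)$ and $r_j\in R^{\pm1}$ let $$f\Big(\prod_{j=1}^m w_jr_jw_j^{-1}\Big)=m+\|w_1\|+\|w_m\|+\sum_{i=1}^{m-1}\|w_i^{-1}w_{i+1}\|,$$ with $f=0$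 for the empty expression ($m=0$). For $g\in F(X)$ with $g=1$ in $G$ let $\lambda(g)$ be the least value of $f$ over all such expressions that equal $g$ in $F(X)$, and let $\Lambda(n)=\max\{\lambda(g) : g=1 \text{ in } G,\ \|g\|\le n\}$. Finally let $t=\max(\{\|r\| : r\in R\}\cup\{2\})$. Then for all $n>2$, $$\frac{\Lambda(n-2)}{2t}\le D_0(n)\le\Lambda(n-2).$$ In particular, $D_0(n)$ is within a constant factor, depending only on the presentation, of $\Lambda(n-2)$. -/

import Mathlib

namespace Miller

/-! ### Word length and conjugator length in a group given by a presentation -/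

section Lengths

variable {A : Type*} {rels : Set (FreeGroup A)}

/-- The length `|γ|` of an element of a group given by a presentation: the least length of a word
in the generators and their inverses that represents `γ`. -/
noncomputable def wordLength (γ : PresentedGroup rels) : ℕ :=
  sInf {k | ∃ L : List (A × Bool), PresentedGroup.mk rels (FreeGroup.mk L) = γ ∧ L.length = k}

/-- The minimum in the definition of `wordLength` is attained. -/
theorem exists_wordLength_eq (γ : PresentedGroup rels) :
    ∃ L : List (A × Bool), PresentedGroup.mk rels (FreeGroup.mk L) = γ ∧
      L.length = wordLength γ := by
  obtain ⟨w, hw⟩ := PresentedGroup.mk_surjective rels γ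
  obtain ⟨L, rfl⟩ := Quot.exists_rep w
  exact Nat.sInf_mem (s := {k | ∃ L : List (A × Bool),
    PresentedGroup.mk rels (FreeGroup.mk L) = γ ∧ L.length = k}) ⟨L.length, L, hw, rfl⟩

/-- The conjugator length `c(x, y)` of two conjugate elements: the least length of an element `γ`
with `γ x γ⁻¹ = y`. -/
noncomputable def conjugatorLength (x y : PresentedGroup rels) : ℕ :=
  sInf {k | ∃ γ : PresentedGroup rels, γ * x * γ⁻¹ = y ∧ wordLength γ = k}

/-- The minimum in the definition of `conjugatorLength` is attained. -/
theorem exists_conjugatorLength_eq {x y : PresentedGroup rels} (h : IsConj x y) :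
    ∃ γ : PresentedGroup rels, γ * x * γ⁻¹ = y ∧ wordLength γ = conjugatorLength x y := by
  obtain ⟨γ, hγ⟩ := isConj_iff.1 h
  exact Nat.sInf_mem (s := {k | ∃ γ : PresentedGroup rels, γ * x * γ⁻¹ = y ∧ wordLength γ = k})
    ⟨_, γ, hγ, rfl⟩

end Lengths

/-! ### The Miller machine -/

section Machine

variable {X : Type*}

/-- The generators of the Miller machine of `⟨X ∣ R⟩`: the letters of `X`, a letter `θ_α` for each
`α` in the disjoint union of `X` and `R`, and a letter `q`. -/
inductive Gen (R : Finset (FreeGroup X)) : Type _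
  | base (x : X) : Gen R
  | theta (α : X ⊕ R) : Gen R
  | q : Gen R

/-- The homomorphism sending a word in `X` to the same word in the generators of the machine. -/
def inclWord (R : Finset (FreeGroup X)) : FreeGroup X →* FreeGroup (Gen R) :=
  FreeGroup.map Gen.base

open FreeGroup in
/-- The defining relations `a = b` of the Miller machine, as relators `a b⁻¹`:
`θ_α x = x θ_α` for `x ∈ X` and `α ∈ X ∪ R`, `θ_x x q = q x θ_x` for `x ∈ X`, and
`θ_r q = q r θ_r` for `r ∈ R`. -/
def machineRels (R : Finset (FreeGroup X)) : Set (FreeGroup (Gen R)) :=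
  {g | ∃ (α : X ⊕ R) (x : X),
      g = (of (Gen.theta α) * of (Gen.base x)) * (of (Gen.base x) * of (Gen.theta α))⁻¹} ∪
  {g | ∃ x : X,
      g = (of (Gen.theta (.inl x)) * of (Gen.base x) * of Gen.q) *
        (of Gen.q * of (Gen.base x) * of (Gen.theta (.inl x)))⁻¹} ∪
  {g | ∃ r : R,
      g = (of (Gen.theta (.inr r)) * of Gen.q) *
        (of Gen.q * inclWord R r * of (Gen.theta (.inr r)))⁻¹}

/-- The Miller machine `M(G)` of the presentation `G = ⟨X ∣ R⟩`. -/
abbrev Machine (R : Finset (FreeGroup X)) : Type _ := PresentedGroup (machineRels R)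

/-- The element `q` of the Miller machine. -/
def q (R : Finset (FreeGroup X)) : Machine R := PresentedGroup.of Gen.q

/-- The element of the Miller machine represented by a word in `X`. -/
def incl (R : Finset (FreeGroup X)) : FreeGroup X →* Machine R :=
  (PresentedGroup.mk (machineRels R)).comp (inclWord R)

end Machine

/-! ### Products of conjugates of relators -/

section Expressions

variable {X : Type*}

/-- `L` is an expression of `g`, in the free group on `X`, as a product `∏ⱼ wⱼ rⱼ wⱼ⁻¹` with each
`rⱼ` a relator or the inverse of a relator. -/
def IsExpression (R : Finset (FreeGroup X)) (g : FreeGroup X)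
    (L : List (FreeGroup X × FreeGroup X)) : Prop :=
  (∀ p ∈ L, p.2 ∈ R ∨ p.2⁻¹ ∈ R) ∧ (L.map fun p => p.1 * p.2 * p.1⁻¹).prod = g

/-- An element that is trivial in `⟨X ∣ R⟩` has such an expression. -/
theorem exists_isExpression (R : Finset (FreeGroup X)) {g : FreeGroup X}
    (hg : PresentedGroup.mk (R : Set (FreeGroup X)) g = 1) : ∃ L, IsExpression R g L := by
  rw [PresentedGroup.mk_eq_one_iff, Subgroup.normalClosure] at hg
  induction hg using Subgroup.closure_induction with
  | mem x hx =>
    obtain ⟨r, hr, hc⟩ := Group.mem_conjugatesOfSet_iff.1 hx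
    obtain ⟨w, hw⟩ := isConj_iff.1 hc
    exact ⟨[(w, r)], by simpa using Or.inl hr, by simpa using hw⟩
  | one => exact ⟨[], by simp, by simp⟩
  | mul x y _ _ hx hy =>
    obtain ⟨L, hL, hLx⟩ := hx
    obtain ⟨K, hK, hKy⟩ := hy
    refine ⟨L ++ K, fun p hp => ?_, by rw [List.map_append, List.prod_append, hLx, hKy]⟩
    exact (List.mem_append.1 hp).elim (hL p) (hK p)
  | inv x _ hx =>
    obtain ⟨L, hL, hLx⟩ := hx
    refine ⟨(L.map fun p => (p.1, p.2⁻¹)).reverse, fun p hp => ?_, ?_⟩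
    · simp only [List.mem_reverse, List.mem_map] at hp
      obtain ⟨p', hp', rfl⟩ := hp
      simpa using (hL p' hp').symm
    · rw [← hLx, List.prod_inv_reverse, List.map_reverse, List.map_map, List.map_map]
      congr 2
      refine List.map_congr_left fun p _ => ?_
      simp [mul_assoc]

end Expressions

/-! ### The functions `Λ` and `D₀` -/

section Functions

variable {X : Type*} [DecidableEq X]

/-- The number `f` attached to an expression `∏ⱼ wⱼ rⱼ wⱼ⁻¹` (`1 ≤ j ≤ m`), the expression being
given as the list of the pairs `(wⱼ, rⱼ)`:
`m + ‖w₁‖ + ‖wₘ‖ + ∑_{i < m} ‖wᵢ⁻¹ wᵢ₊₁‖`. It is `0` for the empty product. -/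
def fLength (L : List (FreeGroup X × FreeGroup X)) : ℕ :=
  L.length + ((L.map Prod.fst).headD 1).norm + ((L.map Prod.fst).getLastD 1).norm +
    (List.zipWith (fun a b => (a⁻¹ * b).norm) (L.map Prod.fst) (L.map Prod.fst).tail).sum

/-- `λ(g)`: the least `f`-length of an expression of `g`. -/
noncomputable def lam (R : Finset (FreeGroup X)) (g : FreeGroup X) : ℕ :=
  sInf {k | ∃ L, IsExpression R g L ∧ fLength L = k}

/-- The set of the values `λ(g)` for `g` with `g = 1` in `G = ⟨X ∣ R⟩` and `‖g‖ ≤ n`. -/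
def lamValues (R : Finset (FreeGroup X)) (n : ℕ) : Set ℕ :=
  {k | ∃ g : FreeGroup X,
    PresentedGroup.mk (R : Set (FreeGroup X)) g = 1 ∧ g.norm ≤ n ∧ k = lam R g}

/-- `Λ(n)`: the largest `λ(g)` with `g = 1` in `G = ⟨X ∣ R⟩` and `‖g‖ ≤ n`. -/
noncomputable def Lam (R : Finset (FreeGroup X)) (n : ℕ) : ℕ := sSup (lamValues R n)

/-- The set of the values `c(q, qu)` for words `u` in `X` with `q` conjugate to `qu` in `M(G)` and
`‖u‖ ≤ n - 2`. -/
def dZeroValues (R : Finset (FreeGroup X)) (n : ℕ) : Set ℕ :=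
  {k | ∃ u : FreeGroup X,
    IsConj (q R) (q R * incl R u) ∧ u.norm + 2 ≤ n ∧
      k = conjugatorLength (q R) (q R * incl R u)}

/-- `D₀(n)`: the largest `c(q, qu)` over words `u` in `X` with `q` conjugate to `qu` in `M(G)` and
`‖u‖ ≤ n - 2`. -/
noncomputable def dZero (R : Finset (FreeGroup X)) (n : ℕ) : ℕ := sSup (dZeroValues R n)

/-- `t = max ({‖r‖ : r ∈ R} ∪ {2})`. -/
def tMax (R : Finset (FreeGroup X)) : ℕ := max (R.sup FreeGroup.norm) 2

/-! The minima and maxima above are attained, so none of these values is a default value. -/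

theorem exists_lam_eq (R : Finset (FreeGroup X)) {g : FreeGroup X}
    (hg : PresentedGroup.mk (R : Set (FreeGroup X)) g = 1) :
    ∃ L, IsExpression R g L ∧ fLength L = lam R g := by
  obtain ⟨L, hL⟩ := exists_isExpression R hg
  exact Nat.sInf_mem (s := {k | ∃ L, IsExpression R g L ∧ fLength L = k}) ⟨_, L, hL, rfl⟩

theorem finite_norm_le [Finite X] (n : ℕ) : {g : FreeGroup X | g.norm ≤ n}.Finite :=
  ((List.finite_length_le (X × Bool) n).preimage FreeGroup.toWord_injective.injOn)

theorem isGreatest_Lam [Finite X] (R : Finset (FreeGroup X)) (n : ℕ) :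
    IsGreatest (lamValues R n) (Lam R n) := by
  have hf : (lamValues R n).Finite :=
    ((finite_norm_le n).image (lam R)).subset fun k ⟨g, _, hn, hk⟩ => ⟨g, hn, hk.symm⟩
  have hne : (lamValues R n).Nonempty := ⟨_, 1, map_one _, by simp, rfl⟩
  exact ⟨Nat.sSup_mem hne hf.bddAbove, fun _ hk => le_csSup hf.bddAbove hk⟩

theorem isGreatest_dZero [Finite X] (R : Finset (FreeGroup X)) {n : ℕ} (hn : 2 ≤ n) :
    IsGreatest (dZeroValues R n) (dZero R n) := by
  have hf : (dZeroValues R n).Finite :=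
    ((finite_norm_le n).image fun u => conjugatorLength (q R) (q R * incl R u)).subset
      fun k ⟨u, _, hu, hk⟩ => ⟨u, (Nat.le_add_right _ _).trans hu, hk.symm⟩
  have hne : (dZeroValues R n).Nonempty :=
    ⟨_, 1, by rw [map_one, mul_one], by simpa using hn, rfl⟩
  exact ⟨Nat.sSup_mem hne hf.bddAbove, fun _ hk => le_csSup hf.bddAbove hk⟩

end Functions

end Miller

/-! The elements `q` and `qu` are conjugate exactly when `u = 1` in `G`, so both maxima range over
the same words `u`. It remains to compare `c(q, qu)` with `λ(u)` for one word.

Upper bound (`conjugatorLength_le_lam`). Write `θ(w)` for the word `w` spelled in the letters `θ_x`.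
All letters `θ_α` commute with `X`, `θ(w)` conjugates `q` to `w⁻¹qw`, and `θ_r` conjugates `q` to
`qr`. Hence `θ(w) θ_r θ(w)⁻¹` conjugates `q` to `q·wrw⁻¹`. Multiplying such elements along an
expression of `u` gives a conjugator from `q` to `qu`. Neighbouring factors merge as `θ(wᵢ)⁻¹θ(wᵢ₊₁)
= θ(wᵢ⁻¹wᵢ₊₁)`, so its length is at most `f`.

Lower bound (`lam_le_two_mul_conjugatorLength`). Let `β` send `θ_x` to `x` and kill the other
letters, and let `ρ` differ from `β` only in sending `θ_r` to `r`. An action of the machine on `F(X)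
× F(X)` shows that a word `W` conjugating `q` to `qu` satisfies `u = ρ(W)β(W)⁻¹` (`eq_of_conj_q`).
Reading `W` letter by letter writes this as a product of conjugates of relators, one for each letter
`θ_r^{±1}`, whose `f`-length without the term `‖wₘ‖` is at most `|W|`. The triangle inequality
bounds `‖wₘ‖` by `|W|` too, so `λ(u) ≤ 2c(q, qu)`. This constant 2 is sharper than `2t`. -/

namespace Miller

/-! ### Word length -/

section Lengths

variable {A : Type*} {rels : Set (FreeGroup A)}

theorem wordLength_mk_le (L : List (A × Bool)) :
    wordLength (PresentedGroup.mk rels (FreeGroup.mk L)) ≤ L.length :=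
  Nat.sInf_le ⟨L, rfl, rfl⟩

theorem wordLength_mul_le (γ δ : PresentedGroup rels) :
    wordLength (γ * δ) ≤ wordLength γ + wordLength δ := by
  obtain ⟨L, hL, hL'⟩ := exists_wordLength_eq γ
  obtain ⟨K, hK, hK'⟩ := exists_wordLength_eq δ
  have h := wordLength_mk_le (rels := rels) (L ++ K)
  rwa [← FreeGroup.mul_mk, map_mul, hL, hK, List.length_append, hL', hK'] at h

theorem wordLength_inv_le (γ : PresentedGroup rels) : wordLength γ⁻¹ ≤ wordLength γ := by
  obtain ⟨L, hL, hL'⟩ := exists_wordLength_eq γ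
  have h := wordLength_mk_le (rels := rels) (FreeGroup.invRev L)
  rwa [← FreeGroup.inv_mk, map_inv, hL, FreeGroup.invRev_length, hL'] at h

theorem wordLength_one : wordLength (1 : PresentedGroup rels) = 0 :=
  Nat.le_zero.1 (wordLength_mk_le (rels := rels) [])

theorem wordLength_of_le (a : A) : wordLength (PresentedGroup.of (rels := rels) a) ≤ 1 :=
  wordLength_mk_le (rels := rels) [(a, true)]

/-- A homomorphism renaming letters does not increase length. -/
theorem wordLength_mk_map_le {B : Type*} [DecidableEq B] (f : B → A) (w : FreeGroup B) :
    wordLength (PresentedGroup.mk rels (FreeGroup.map f w)) ≤ w.norm := by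
  have h := wordLength_mk_le (rels := rels) (w.toWord.map fun p => (f p.1, p.2))
  rwa [← FreeGroup.map.mk, FreeGroup.mk_toWord, List.length_map] at h

theorem conjugatorLength_le {x y γ : PresentedGroup rels} (h : γ * x * γ⁻¹ = y) :
    conjugatorLength x y ≤ wordLength γ :=
  Nat.sInf_le ⟨γ, h, rfl⟩

end Lengths

/-! ### Relations in the Miller machine -/

section Machine

variable {X : Type*} (R : Finset (FreeGroup X))

/-- The element `θ_α` of the Miller machine. -/
def theta (α : X ⊕ R) : Machine R := PresentedGroup.of (Gen.theta α)

/-- The homomorphism sending a word in `X` to the same word in the letters `θ_x`. -/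
def thetaWord : FreeGroup X →* Machine R :=
  (PresentedGroup.mk (machineRels R)).comp (FreeGroup.map fun x => Gen.theta (.inl x))

theorem incl_of (x : X) : incl R (FreeGroup.of x) = PresentedGroup.of (Gen.base x) := by
  simp [incl, inclWord, PresentedGroup.of]

theorem thetaWord_of (x : X) : thetaWord R (FreeGroup.of x) = theta R (.inl x) := by
  simp [thetaWord, theta, PresentedGroup.of]

theorem mk_eq_of_mem {a b : FreeGroup (Gen R)} (h : a * b⁻¹ ∈ machineRels R) :
    PresentedGroup.mk (machineRels R) a = PresentedGroup.mk (machineRels R) b := by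
  have := PresentedGroup.one_of_mem h
  rwa [map_mul, map_inv, mul_inv_eq_one] at this

theorem commute_theta_incl (α : X ⊕ R) (v : FreeGroup X) : Commute (theta R α) (incl R v) := by
  induction v using FreeGroup.induction_on with
  | C1 => simp
  | of x =>
    rw [incl_of]
    have := mk_eq_of_mem R (Or.inl (Or.inl ⟨α, x, rfl⟩))
    simp only [map_mul] at this
    exact this
  | inv_of x h => rw [map_inv]; exact h.inv_right
  | mul x y hx hy => rw [map_mul]; exact hx.mul_right hy

theorem commute_thetaWord_incl (w v : FreeGroup X) :
    Commute (thetaWord R w) (incl R v) := by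
  induction w using FreeGroup.induction_on with
  | C1 => simp
  | of x => rw [thetaWord_of]; exact commute_theta_incl R _ v
  | inv_of x h => rw [map_inv]; exact h.inv_left
  | mul x y hx hy => rw [map_mul]; exact hx.mul_left hy

/-- The product of a word in the letters `θ_x` and the same word in `X` commutes with `q`. -/
theorem commute_thetaWord_mul_incl_q (w : FreeGroup X) :
    Commute (thetaWord R w * incl R w) (q R) := by
  induction w using FreeGroup.induction_on with
  | C1 => simp
  | of x =>
    have h := mk_eq_of_mem R (Or.inl (Or.inr ⟨x, rfl⟩))
    simp only [map_mul] at h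
    have hc := (commute_theta_incl R (.inl x) (FreeGroup.of x)).eq
    rw [thetaWord_of]
    rw [Commute, SemiconjBy]
    calc theta R (.inl x) * incl R (FreeGroup.of x) * q R
        = q R * incl R (FreeGroup.of x) * theta R (.inl x) := by rw [incl_of]; exact h
      _ = q R * (theta R (.inl x) * incl R (FreeGroup.of x)) := by rw [hc, mul_assoc]
  | inv_of x h =>
    have hc := commute_thetaWord_incl R (FreeGroup.of x) (FreeGroup.of x)
    rw [map_inv, map_inv, ← mul_inv_rev, ← hc.eq]
    exact h.inv_left
  | mul x y hx hy =>
    have hc := commute_thetaWord_incl R y x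
    have : thetaWord R (x * y) * incl R (x * y)
        = (thetaWord R x * incl R x) * (thetaWord R y * incl R y) := by
      rw [map_mul, map_mul, mul_assoc, ← mul_assoc (thetaWord R y), hc.eq]
      simp only [mul_assoc]
    rw [this]
    exact hx.mul_left hy

theorem theta_relator_mul_q (r : R) :
    theta R (.inr r) * q R = q R * incl R r * theta R (.inr r) := by
  have h := mk_eq_of_mem R (Or.inr ⟨r, rfl⟩)
  simp only [map_mul] at h
  exact h

/-- For each relator or inverse of a relator `r`, some letter conjugates `q` to `qr`. -/
theorem exists_letter_mul_q {r : FreeGroup X} (hr : r ∈ R ∨ r⁻¹ ∈ R) :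
    ∃ δ : Machine R, wordLength δ ≤ 1 ∧ (∀ v, Commute δ (incl R v)) ∧
      δ * q R = q R * incl R r * δ := by
  rcases hr with hr | hr
  · exact ⟨theta R (.inr ⟨r, hr⟩), wordLength_of_le _, commute_theta_incl R _,
      theta_relator_mul_q R ⟨r, hr⟩⟩
  · set δ := theta R (.inr ⟨r⁻¹, hr⟩)
    refine ⟨δ⁻¹, (wordLength_inv_le _).trans (wordLength_of_le _),
      fun v => (commute_theta_incl R _ v).inv_left, ?_⟩
    have h : δ * q R = q R * incl R r⁻¹ * δ := theta_relator_mul_q R ⟨r⁻¹, hr⟩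
    have hc : Commute δ (incl R r) := commute_theta_incl R _ r
    rw [inv_mul_eq_iff_eq_mul, ← mul_assoc, ← mul_assoc, h, mul_assoc _ δ, hc.eq, map_inv]
    group

end Machine

/-! ### Operations on expressions -/

section Expressions

variable {X : Type*} {R : Finset (FreeGroup X)}

theorem IsExpression.tail {g w r : FreeGroup X}
    {L : List (FreeGroup X × FreeGroup X)} (h : IsExpression R g ((w, r) :: L)) :
    (r ∈ R ∨ r⁻¹ ∈ R) ∧ IsExpression R ((w * r * w⁻¹)⁻¹ * g) L := by
  obtain ⟨h1, h2⟩ := h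
  refine ⟨h1 _ (List.mem_cons_self ..), fun p hp => h1 p (List.mem_cons_of_mem _ hp), ?_⟩
  rw [← h2, List.map_cons, List.prod_cons, inv_mul_cancel_left]

theorem IsExpression.conj {g : FreeGroup X}
    {L : List (FreeGroup X × FreeGroup X)} (h : IsExpression R g L) (x : FreeGroup X) :
    IsExpression R (x * g * x⁻¹) (L.map fun p => (x * p.1, p.2)) := by
  refine ⟨fun p hp => ?_, ?_⟩
  · obtain ⟨p', hp', rfl⟩ := List.mem_map.1 hp
    exact h.1 p' hp'
  · rw [← h.2, ← MulAut.conj_apply, map_list_prod, List.map_map, List.map_map]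
    congr 2
    ext p
    simp [mul_assoc]

end Expressions

/-! ### Short conjugators from expressions -/

section Upper

variable {X : Type*} [DecidableEq X] (R : Finset (FreeGroup X))

/-- Induction on the number of factors. Bounding `θ(w₁)⁻¹γ` rather than `γ` leaves out the cost of
`‖w₁‖`, so that adding a factor in front pays only for the junction with the old first factor. That
`γ` commutes with `X` is what lets partial conjugators be multiplied. -/
theorem exists_conjugator_of_isExpression (L : List (FreeGroup X × FreeGroup X)) :
    ∀ g, IsExpression R g L → ∃ γ : Machine R, (∀ v, Commute γ (incl R v)) ∧
      γ * q R = q R * incl R g * γ ∧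
      wordLength ((thetaWord R ((L.map Prod.fst).headD 1))⁻¹ * γ) ≤
        L.length + ((L.map Prod.fst).getLastD 1).norm +
          (List.zipWith (fun a b => (a⁻¹ * b).norm) (L.map Prod.fst)
            (L.map Prod.fst).tail).sum := by
  induction L with
  | nil =>
    rintro g ⟨-, hg⟩
    obtain rfl : 1 = g := by simpa using hg
    exact ⟨1, fun v => Commute.one_left _, by simp, by simp [wordLength_one]⟩
  | cons p L ih =>
    obtain ⟨w, r⟩ := p
    intro g hg
    obtain ⟨hr, hg'⟩ := hg.tail
    obtain ⟨γ, hc, hq, hl⟩ := ih _ hg'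
    obtain ⟨δ, hδl, hδc, hδq⟩ := exists_letter_mul_q R hr
    have hw := (commute_thetaWord_mul_incl_q R w).eq
    have hwc := commute_thetaWord_incl R w
    have hwq : thetaWord R w * q R = incl R w⁻¹ * q R * incl R w * thetaWord R w := by
      have h2 := (hwc w).eq
      calc thetaWord R w * q R
          = (incl R w)⁻¹ * (thetaWord R w * incl R w * q R) := by rw [h2]; group
        _ = _ := by rw [hw, h2, map_inv]; simp only [mul_assoc]
    have hwq' : (thetaWord R w)⁻¹ * q R = incl R w * q R * incl R w⁻¹ * (thetaWord R w)⁻¹ := by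
      have h1 : thetaWord R w * (incl R w * q R * incl R w⁻¹) = q R * thetaWord R w := by
        calc thetaWord R w * (incl R w * q R * incl R w⁻¹)
            = thetaWord R w * incl R w * q R * incl R w⁻¹ := by simp only [mul_assoc]
          _ = q R * (thetaWord R w * incl R w) * incl R w⁻¹ := by rw [hw]
          _ = q R * thetaWord R w := by simp [mul_assoc]
      rw [inv_mul_eq_iff_eq_mul, ← mul_assoc, h1, mul_assoc, mul_inv_cancel, mul_one]
    refine ⟨thetaWord R w * δ * (thetaWord R w)⁻¹ * γ, fun v =>
      (((hwc v).mul_left (hδc v)).mul_left (hwc v).inv_left).mul_left (hc v), ?_, ?_⟩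
    · have hs : SemiconjBy (thetaWord R w * δ * (thetaWord R w)⁻¹) (q R)
          (q R * incl R (w * r * w⁻¹)) := by
        have e3 : SemiconjBy (thetaWord R w)⁻¹ (q R) (incl R w * q R * incl R w⁻¹) := hwq'
        have e2 : SemiconjBy δ (incl R w * q R * incl R w⁻¹)
            (incl R w * (q R * incl R r) * incl R w⁻¹) :=
          SemiconjBy.mul_right (SemiconjBy.mul_right (hδc w) hδq) (hδc w⁻¹)
        have e1 : SemiconjBy (thetaWord R w) (incl R w * (q R * incl R r) * incl R w⁻¹)
            (incl R w * (incl R w⁻¹ * q R * incl R w * incl R r) * incl R w⁻¹) :=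
          SemiconjBy.mul_right (SemiconjBy.mul_right (hwc w)
            (SemiconjBy.mul_right hwq (hwc r))) (hwc w⁻¹)
        have e := (e1.mul_left e2).mul_left e3
        have hy : incl R w * (incl R w⁻¹ * q R * incl R w * incl R r) * incl R w⁻¹
            = q R * incl R (w * r * w⁻¹) := by
          simp only [map_mul, map_inv]; group
        rwa [hy] at e
      -- The inductive `γ` takes `q` to `q` times the remaining product; the new factor acts on that
      -- `q` and passes through the word in `X` unchanged.
      have hcs : SemiconjBy (thetaWord R w * δ * (thetaWord R w)⁻¹)
          (incl R ((w * r * w⁻¹)⁻¹ * g)) (incl R ((w * r * w⁻¹)⁻¹ * g)) :=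
        ((hwc _).mul_left (hδc _)).mul_left (hwc _).inv_left
      have hfin := (hs.mul_right hcs).mul_left hq
      rw [mul_assoc (q R), ← map_mul, mul_inv_cancel_left] at hfin
      exact hfin
    -- For the last factor, `θ(w)⁻¹` stays and costs `‖wₘ‖`; otherwise it merges with the next
    -- `θ(w')`.
    · cases L with
      | nil =>
        have hlen := wordLength_mk_map_le (rels := machineRels R)
          (fun x => Gen.theta (R := R) (.inl x)) w
        have hγ : wordLength γ ≤ 0 := by simpa using hl
        have he : (thetaWord R w)⁻¹ * (thetaWord R w * δ * (thetaWord R w)⁻¹ * γ)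
            = δ * (thetaWord R w)⁻¹ * γ := by group
        have t1 := wordLength_mul_le (δ * (thetaWord R w)⁻¹) γ
        have t2 := wordLength_mul_le δ (thetaWord R w)⁻¹
        have t3 : wordLength (thetaWord R w)⁻¹ ≤ w.norm := (wordLength_inv_le _).trans hlen
        simp only [List.map_cons, List.map_nil, List.headD_cons, he, List.getLastD_cons,
          List.getLastD_nil, List.length_cons, List.length_nil, List.tail_cons,
          List.zipWith_nil_right, List.sum_nil]
        omega
      | cons p L =>
        obtain ⟨w', r'⟩ := p
        have he : (thetaWord R w)⁻¹ * (thetaWord R w * δ * (thetaWord R w)⁻¹ * γ)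
            = δ * (thetaWord R (w⁻¹ * w')) * ((thetaWord R w')⁻¹ * γ) := by
          rw [map_mul, map_inv]; group
        have t1 := wordLength_mul_le (δ * (thetaWord R (w⁻¹ * w'))) ((thetaWord R w')⁻¹ * γ)
        have t2 := wordLength_mul_le δ (thetaWord R (w⁻¹ * w'))
        have t3 : wordLength (thetaWord R (w⁻¹ * w')) ≤ (w⁻¹ * w').norm :=
          wordLength_mk_map_le (rels := machineRels R)
            (fun x => Gen.theta (R := R) (.inl x)) (w⁻¹ * w')
        simp only [List.map_cons, List.headD_cons, List.getLastD_cons,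
          List.length_cons, List.tail_cons, List.zipWith_cons_cons, List.sum_cons, he] at hl ⊢
        omega

theorem exists_conjugator_le_fLength {g : FreeGroup X} {L : List (FreeGroup X × FreeGroup X)}
    (h : IsExpression R g L) :
    ∃ γ : Machine R, γ * q R * γ⁻¹ = q R * incl R g ∧ wordLength γ ≤ fLength L := by
  obtain ⟨γ, -, hq, hl⟩ := exists_conjugator_of_isExpression R L g h
  refine ⟨γ, by rw [hq]; group, ?_⟩
  set w := (L.map Prod.fst).headD 1 with hw
  have t1 := wordLength_mul_le (thetaWord R w) ((thetaWord R w)⁻¹ * γ)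
  have t2 : wordLength (thetaWord R w) ≤ w.norm :=
    wordLength_mk_map_le (rels := machineRels R) (fun x => Gen.theta (R := R) (.inl x)) w
  rw [mul_inv_cancel_left] at t1
  rw [fLength, ← hw]
  omega

theorem isConj_q_of_mk_eq_one {g : FreeGroup X}
    (hg : PresentedGroup.mk (R : Set (FreeGroup X)) g = 1) :
    IsConj (q R) (q R * incl R g) := by
  obtain ⟨L, hL⟩ := exists_isExpression R hg
  obtain ⟨γ, hγ, -⟩ := exists_conjugator_le_fLength R hL
  exact isConj_iff.2 ⟨γ, hγ⟩

theorem conjugatorLength_le_lam {g : FreeGroup X}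
    (hg : PresentedGroup.mk (R : Set (FreeGroup X)) g = 1) :
    conjugatorLength (q R) (q R * incl R g) ≤ lam R g := by
  obtain ⟨L, hL, hf⟩ := exists_lam_eq R hg
  obtain ⟨γ, hγ, hl⟩ := exists_conjugator_le_fLength R hL
  exact (conjugatorLength_le hγ).trans (hf ▸ hl)

end Upper

/-! ### Homomorphisms from the Miller machine -/

section Homs

variable {X : Type*} (R : Finset (FreeGroup X))

/-- A homomorphism from the Miller machine is given by images of `X`, the `θ_α` and `q` that
satisfy the defining relations. -/
theorem lift_machineRels_eq_one {H : Type*} [Group H] (f : Gen R → H)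
    (hc : ∀ α x, Commute (f (.theta α)) (f (.base x)))
    (hx : ∀ x, f (.theta (.inl x)) * f (.base x) * f .q =
      f .q * f (.base x) * f (.theta (.inl x)))
    (hr : ∀ r : R, f (.theta (.inr r)) * f .q =
      f .q * FreeGroup.lift (fun x => f (.base x)) (r : FreeGroup X) * f (.theta (.inr r))) :
    ∀ g ∈ machineRels R, FreeGroup.lift f g = 1 := by
  have hincl : ∀ v : FreeGroup X, FreeGroup.lift f (inclWord R v) =
      FreeGroup.lift (fun x => f (.base x)) v := by
    intro v
    have : (FreeGroup.lift f).comp (inclWord R) = FreeGroup.lift (fun x => f (.base x)) := by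
      ext x
      simp [inclWord]
    exact DFunLike.congr_fun this v
  rintro g ((⟨α, x, rfl⟩ | ⟨x, rfl⟩) | ⟨r, rfl⟩) <;>
    rw [map_mul, map_inv, mul_inv_eq_one] <;>
    simp only [map_mul, FreeGroup.lift_apply_of, hincl]
  · exact hc α x
  · exact hx x
  · exact hr r

/-- If `q` and `qg` are conjugate then `g = 1` in `G`, because deleting `q` and the letters
`θ_α` maps the Miller machine onto `G`. -/
theorem mk_eq_one_of_isConj_q {g : FreeGroup X} (h : IsConj (q R) (q R * incl R g)) :
    PresentedGroup.mk (R : Set (FreeGroup X)) g = 1 := by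
  let G := PresentedGroup (R : Set (FreeGroup X))
  let f : Gen R → G := fun a => match a with
    | .base x => PresentedGroup.of x
    | .theta _ => 1
    | .q => 1
  have hb : FreeGroup.lift (fun x => f (.base x)) = PresentedGroup.mk (R : Set (FreeGroup X)) := by
    ext x
    simp [f, PresentedGroup.of]
  have hf : ∀ a ∈ machineRels R, FreeGroup.lift f a = 1 := by
    refine lift_machineRels_eq_one R f (fun _ _ => Commute.one_left _) (fun x => ?_) (fun r => ?_)
    · simp [f]
    · rw [hb, PresentedGroup.one_of_mem r.2]; simp [f]
  let Φ : Machine R →* G := PresentedGroup.toGroup hf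
  have hq : Φ (q R) = 1 := PresentedGroup.toGroup.of hf
  have hi : Φ.comp (incl R) = PresentedGroup.mk (R : Set (FreeGroup X)) := by
    ext x
    simp only [MonoidHom.comp_apply, incl_of]
    exact PresentedGroup.toGroup.of hf
  have h' := Φ.map_isConj h
  rw [map_mul, hq, one_mul, isConj_one_right] at h'
  rw [← hi]
  exact h'

/-- The images of the letters under the homomorphism that deletes `X`, `q` and the `θ_r`, and
replaces `θ_x` by `x`. -/
def baseLetter : Gen R → FreeGroup X
  | .theta (.inl x) => .of x
  | _ => 1

/-- The images of the letters under the homomorphism that deletes `X` and `q`, and replaces `θ_x`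
by `x` and `θ_r` by `r`. -/
def relatorLetter : Gen R → FreeGroup X
  | .theta (.inl x) => .of x
  | .theta (.inr r) => r
  | _ => 1

/-- The permutations of `F(X) × F(X)` by which the letters of the Miller machine act. -/
def letterPerm : Gen R → Equiv.Perm (FreeGroup X × FreeGroup X)
  | .base x =>
    { toFun := fun p => (.of x * p.1, p.2)
      invFun := fun p => ((.of x)⁻¹ * p.1, p.2)
      left_inv := fun p => by simp
      right_inv := fun p => by simp }
  | .theta α =>
    { toFun := fun p => (p.1, baseLetter R (.theta α) * p.2 * (relatorLetter R (.theta α))⁻¹)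
      invFun := fun p => (p.1, (baseLetter R (.theta α))⁻¹ * p.2 * relatorLetter R (.theta α))
      left_inv := fun p => by simp [mul_assoc]
      right_inv := fun p => by simp [mul_assoc] }
  | .q =>
    { toFun := fun p => (p.2 * p.1, p.2)
      invFun := fun p => (p.2⁻¹ * p.1, p.2)
      left_inv := fun p => by simp
      right_inv := fun p => by simp }

theorem lift_letterPerm_base (v : FreeGroup X) (p : FreeGroup X × FreeGroup X) :
    FreeGroup.lift (fun x => letterPerm R (.base x)) v p = (v * p.1, p.2) := by
  induction v using FreeGroup.induction_on generalizing p with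
  | C1 => simp
  | of x => simp [letterPerm]
  | inv_of x h => rw [map_inv, Equiv.Perm.inv_eq_iff_eq, h]; simp
  | mul x y hx hy => rw [map_mul, Equiv.Perm.mul_apply, hy, hx]; simp [mul_assoc]

/-- Writing `(c, s)` for a point, both sides of the `θ_r` relation give `(sc, sr⁻¹)`, because the
`r⁻¹` that `θ_r` puts on `s` cancels the `r` put on `c`. Both sides of the `θ_x` relation give
`(xsc, xsx⁻¹)`. -/
theorem lift_letterPerm_eq_one : ∀ g ∈ machineRels R, FreeGroup.lift (letterPerm R) g = 1 := by
  refine lift_machineRels_eq_one R _ (fun α x => ?_) (fun x => ?_) (fun r => ?_)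
  · ext p : 1
    simp [letterPerm]
  · ext p : 1
    simp [letterPerm, baseLetter, relatorLetter, mul_assoc]
  · ext p : 1
    simp only [Equiv.Perm.mul_apply, lift_letterPerm_base]
    simp [letterPerm, baseLetter, relatorLetter, mul_assoc]

/-- The action of the Miller machine on `F(X) × F(X)`. -/
def machinePerm : Machine R →* Equiv.Perm (FreeGroup X × FreeGroup X) :=
  PresentedGroup.toGroup (lift_letterPerm_eq_one R)

theorem machinePerm_mk (w : FreeGroup (Gen R)) :
    machinePerm R (PresentedGroup.mk _ w) = FreeGroup.lift (letterPerm R) w := rfl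

theorem machinePerm_q (p : FreeGroup X × FreeGroup X) :
    machinePerm R (q R) p = (p.2 * p.1, p.2) := by
  have : machinePerm R (q R) = letterPerm R .q := PresentedGroup.toGroup.of _
  rw [this]
  rfl

theorem machinePerm_incl (v : FreeGroup X) (p : FreeGroup X × FreeGroup X) :
    machinePerm R (incl R v) p = (v * p.1, p.2) := by
  have : (machinePerm R).comp (incl R) = FreeGroup.lift (fun x => letterPerm R (.base x)) := by
    ext x : 1
    simp only [MonoidHom.comp_apply, incl_of, FreeGroup.lift_apply_of]
    exact PresentedGroup.toGroup.of _
  rw [← lift_letterPerm_base R, ← this]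
  rfl

/-- The action on the second factor is by left and right multiplication, and the action on the
first factor is by left multiplication by an element depending only on the second coordinate. -/
theorem exists_lift_letterPerm_apply (w : FreeGroup (Gen R)) :
    ∃ k : FreeGroup X → FreeGroup X, ∀ c s, FreeGroup.lift (letterPerm R) w (c, s) =
      (k s * c, FreeGroup.lift (baseLetter R) w * s * (FreeGroup.lift (relatorLetter R) w)⁻¹) := by
  induction w using FreeGroup.induction_on with
  | C1 => exact ⟨fun _ => 1, by simp⟩
  | of a =>
    rcases a with x | α | _
    · exact ⟨fun _ => .of x, by simp [letterPerm, baseLetter, relatorLetter]⟩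
    · exact ⟨fun _ => 1, by simp [letterPerm]⟩
    · exact ⟨fun s => s, by simp [letterPerm, baseLetter, relatorLetter]⟩
  | inv_of a h =>
    obtain ⟨k, hk⟩ := h
    refine ⟨fun s => (k ((FreeGroup.lift (baseLetter R) (.of a))⁻¹ * s *
      FreeGroup.lift (relatorLetter R) (.of a)))⁻¹, fun c s => ?_⟩
    simp only [map_inv]
    rw [Equiv.Perm.inv_eq_iff_eq, inv_inv, hk]
    simp [mul_assoc]
  | mul x y hx hy =>
    obtain ⟨k, hk⟩ := hx
    obtain ⟨l, hl⟩ := hy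
    refine ⟨fun s => k (FreeGroup.lift (baseLetter R) y * s *
      (FreeGroup.lift (relatorLetter R) y)⁻¹) * l s, fun c s => ?_⟩
    rw [map_mul, Equiv.Perm.mul_apply, hl, hk]
    simp [mul_assoc]

/-- A word conjugating `q` to `qu` determines `u`. -/
theorem eq_of_conj_q {w : FreeGroup (Gen R)} {u : FreeGroup X}
    (h : PresentedGroup.mk (machineRels R) w * q R * (PresentedGroup.mk (machineRels R) w)⁻¹ =
      q R * incl R u) :
    u = FreeGroup.lift (relatorLetter R) w * (FreeGroup.lift (baseLetter R) w)⁻¹ := by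
  obtain ⟨k, hk⟩ := exists_lift_letterPerm_apply R w
  rw [mul_inv_eq_iff_eq_mul] at h
  -- The point `(1, 1)` is fixed by `q`. Both sides then have first coordinate ending in the same
  -- factor `k 1`, and cancelling it leaves `β(w)ρ(w)⁻¹u = 1`.
  have h' := DFunLike.congr_fun (congrArg (machinePerm R) h) ((1, 1) : FreeGroup X × FreeGroup X)
  simp only [map_mul, Equiv.Perm.mul_apply, machinePerm_q, machinePerm_incl, machinePerm_mk, hk,
    mul_one, Prod.mk.injEq, and_true] at h'
  rw [← mul_assoc, right_eq_mul] at h'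
  rw [eq_inv_of_mul_eq_one_right h', mul_inv_rev, inv_inv]

end Homs

/-! ### Short expressions from conjugators -/

section Lower

variable {X : Type*} [DecidableEq X] (R : Finset (FreeGroup X))

/-- The last vertex of a path in the free group is no farther from `1` than the length of the path
together with the distance of its first vertex from `1`. -/
theorem norm_getLastD_le (l : List (FreeGroup X)) :
    (l.getLastD 1).norm ≤ (l.headD 1).norm +
      (List.zipWith (fun a b => (a⁻¹ * b).norm) l l.tail).sum := by
  induction l with
  | nil => simp
  | cons a l ih =>
    cases l with
    | nil => simp
    | cons b l =>
      have hb : b.norm ≤ a.norm + (a⁻¹ * b).norm := by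
        simpa using FreeGroup.norm_mul_le a (a⁻¹ * b)
      simp only [List.getLastD_cons, List.headD_cons, List.tail_cons, List.zipWith_cons_cons,
        List.sum_cons] at ih ⊢
      omega

theorem zipWith_map_mul_left (x : FreeGroup X) (l : List (FreeGroup X)) :
    List.zipWith (fun a b => (a⁻¹ * b).norm) (l.map (x * ·)) (l.map (x * ·)).tail =
      List.zipWith (fun a b => (a⁻¹ * b).norm) l l.tail := by
  rw [← List.map_tail, List.zipWith_map]
  simp [mul_assoc]

/-- Letters are prepended one at a time, and each raises the left side by at most 1. The `wⱼ` are
the values of `β` on the prefixes of `W` before the letters `θ_r^{±1}`. The term `‖wₘ‖` is omitted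
because the `θ_x` letters after the last relator need not spell `wₘ⁻¹`. -/
theorem exists_isExpression_of_word (W : List (Gen R × Bool)) :
    ∃ L, IsExpression R (FreeGroup.lift (relatorLetter R) (.mk W) *
        (FreeGroup.lift (baseLetter R) (.mk W))⁻¹) L ∧
      L.length + ((L.map Prod.fst).headD 1).norm +
        (List.zipWith (fun a b => (a⁻¹ * b).norm) (L.map Prod.fst) (L.map Prod.fst).tail).sum ≤
        W.length := by
  induction W with
  | nil => exact ⟨[], ⟨by simp, by simp⟩, by simp⟩
  | cons a W ih =>
    obtain ⟨L, hL, hl⟩ := ih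
    obtain ⟨a, b⟩ := a
    have hcons : (FreeGroup.mk ((a, b) :: W) : FreeGroup (Gen R)) = .mk [(a, b)] * .mk W := by
      rw [FreeGroup.mul_mk]; rfl
    have he : FreeGroup.lift (relatorLetter R) (.mk ((a, b) :: W)) *
        (FreeGroup.lift (baseLetter R) (.mk ((a, b) :: W)))⁻¹ =
        FreeGroup.lift (relatorLetter R) (.mk [(a, b)]) *
        (FreeGroup.lift (relatorLetter R) (.mk W) * (FreeGroup.lift (baseLetter R) (.mk W))⁻¹) *
        (FreeGroup.lift (baseLetter R) (.mk [(a, b)]))⁻¹ := by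
      rw [hcons, map_mul, map_mul, mul_inv_rev]; simp only [mul_assoc]
    rw [he, List.length_cons]
    generalize FreeGroup.lift (relatorLetter R) (.mk W) *
      (FreeGroup.lift (baseLetter R) (.mk W))⁻¹ = g at hL
    rcases a with x | (x | r) | _
    · refine ⟨L, ?_, by omega⟩
      cases b <;> simpa [relatorLetter, baseLetter] using hL
    · set y : FreeGroup X := .mk [(x, b)] with hy
      have h1 : FreeGroup.lift (relatorLetter R) (.mk [(.theta (.inl x), b)]) = y := by
        cases b <;> simp [relatorLetter, hy, FreeGroup.of, FreeGroup.invRev]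
      have h2 : FreeGroup.lift (baseLetter R) (.mk [(.theta (.inl x), b)]) = y := by
        cases b <;> simp [baseLetter, hy, FreeGroup.of, FreeGroup.invRev]
      rw [h1, h2]
      -- A letter `θ_x^{±1}` conjugates the product by `y`, translating every `wⱼ`: the differences
      -- `wᵢ⁻¹wᵢ₊₁` are unchanged and only `‖w₁‖` can grow, by at most 1.
      refine ⟨_, hL.conj y, ?_⟩
      have hm : (L.map fun p => (y * p.1, p.2)).map Prod.fst = (L.map Prod.fst).map (y * ·) := by
        simp
      rw [hm, zipWith_map_mul_left, List.length_map]
      have hn : y.norm ≤ 1 := FreeGroup.norm_mk_le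
      have : (((L.map Prod.fst).map (y * ·)).headD 1).norm ≤
          ((L.map Prod.fst).headD 1).norm + 1 := by
        cases L with
        | nil => simp
        | cons p L =>
          have := FreeGroup.norm_mul_le y p.1
          simp only [List.map_cons, List.headD_cons]
          omega
      omega
    · have h2 : FreeGroup.lift (baseLetter R) (.mk [(.theta (.inr r), b)]) = 1 := by
        cases b <;> simp [baseLetter]
      rw [h2, inv_one, mul_one]
      -- The new factor has `w = 1`: the old `‖w₁‖` becomes the junction term `‖1⁻¹w₁‖`, the new
      -- first norm is 0, and only the count of factors rises.
      refine ⟨(1, FreeGroup.lift (relatorLetter R) (.mk [(.theta (.inr r), b)])) :: L,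
        ⟨?_, by simp [← hL.2]⟩, ?_⟩
      · rintro p (_ | ⟨_, hp⟩)
        · cases b <;> simp [relatorLetter]
        · exact hL.1 p hp
      · cases L with
        | nil => simp
        | cons p L =>
          simp only [List.map_cons, List.headD_cons, List.tail_cons, List.zipWith_cons_cons,
            List.sum_cons, List.length_cons, inv_one, one_mul, FreeGroup.norm_one] at hl ⊢
          omega
    · refine ⟨L, ?_, by omega⟩
      cases b <;> simpa [relatorLetter, baseLetter] using hL

/-- The factor 2 pays for `‖wₘ‖`, which is bounded by `‖w₁‖` plus the junction terms and hence by
the length of the conjugator once more. -/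
theorem lam_le_two_mul_conjugatorLength {u : FreeGroup X}
    (h : IsConj (q R) (q R * incl R u)) :
    lam R u ≤ 2 * conjugatorLength (q R) (q R * incl R u) := by
  obtain ⟨γ, hγ, hγl⟩ := exists_conjugatorLength_eq h
  obtain ⟨W, rfl, hW⟩ := exists_wordLength_eq γ
  obtain ⟨L, hL, hl⟩ := exists_isExpression_of_word R W
  rw [← eq_of_conj_q R hγ] at hL
  have h1 : lam R u ≤ fLength L := Nat.sInf_le ⟨L, hL, rfl⟩
  have h2 := norm_getLastD_le (L.map Prod.fst)
  rw [fLength] at h1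
  omega

end Lower

/-! ### Comparison of the two maxima. -/

section Main

variable {X : Type*} [Finite X] [DecidableEq X] (R : Finset (FreeGroup X))

theorem dZero_le_Lam {n : ℕ} (hn : 2 ≤ n) : dZero R n ≤ Lam R (n - 2) := by
  obtain ⟨u, hu, hun, hk⟩ := (isGreatest_dZero R hn).1
  have h1 := mk_eq_one_of_isConj_q R hu
  rw [hk]
  exact (conjugatorLength_le_lam R h1).trans
    ((isGreatest_Lam R (n - 2)).2 ⟨u, h1, by omega, rfl⟩)

theorem Lam_le_two_mul_dZero {n : ℕ} (hn : 2 ≤ n) : Lam R (n - 2) ≤ 2 * dZero R n := by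
  obtain ⟨g, hg, hgn, hk⟩ := (isGreatest_Lam R (n - 2)).1
  have hc := isConj_q_of_mk_eq_one R hg
  rw [hk]
  exact (lam_le_two_mul_conjugatorLength R hc).trans
    (Nat.mul_le_mul_left 2 ((isGreatest_dZero R hn).2 ⟨g, hc, by omega, rfl⟩))

end Main

end Miller

theorem theoremB {X : Type*} [Finite X] [DecidableEq X] (R : Finset (FreeGroup X))
    (n : ℕ) (hn : 2 < n) :
    (Miller.Lam R (n - 2) : ℝ) / (2 * (Miller.tMax R : ℝ)) ≤ (Miller.dZero R n : ℝ) ∧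
      (Miller.dZero R n : ℝ) ≤ (Miller.Lam R (n - 2) : ℝ) := by
  have h1 : (Miller.Lam R (n - 2) : ℝ) ≤ 2 * Miller.dZero R n := by
    exact_mod_cast Miller.Lam_le_two_mul_dZero R hn.le
  -- Since `Λ(n - 2) ≤ 2D₀(n)` already holds, only `t ≥ 1` is needed.
  have ht : (1 : ℝ) ≤ Miller.tMax R := by
    exact_mod_cast (show 1 ≤ 2 by norm_num).trans (le_max_right (R.sup FreeGroup.norm) 2)
  refine ⟨?_, by exact_mod_cast Miller.dZero_le_Lam R hn.le⟩
  rw [div_le_iff₀ (by linarith)]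
  nlinarith [Nat.cast_nonneg (α := ℝ) (Miller.dZero R n)]
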